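/- Let $K$ be a field, $P=K[x_1,\dots,x_n]$, let $I\subsetneq P$ be an ideal such that $R=P/I$ is a finite-dimensional $K$-vector space. For $i\in\mathbb Z$ let $F_iP$ be the set of polynomials of degree at most $i$, together with $0$, let $F_iR$ be the image of $F_iP$ in $R$, and let $\mathrm{HF}^a(i)=\dim_K F_iR$ be the affine Hilbert function. The order $\mathrm{ord}(f)$ of $f\in R\setminus\{0\}$ is the integer $i$ with $f\in F_iR\setminus F_{i-1}R$. A tuple $B$ in $R$ is a *degree filtered $K$-basis* of $R$ if for every $i\in\mathbb Z$ the members of $B$ lying in $F_iR$ form a $K$-basis of $F_iR$ and the orders of the members of $B$ are weakly increasing. The degree form $\mathrm{DF}(f)$ of $f\in P\setminus\{0\}$ is its homogeneous component of highest degree, and $\mathrm{DF}(I)$ is the ideal generated by all $\mathrm{DF}(f)$ with $f\in I\setminus\{0\}$. Let $\mathcal O=\{t_1,\dots,t_\mu\}$ be a finite set of $\mu$ distinct terms (power products of the $x_k$) that contains all divisors of its elements, with $\deg(t_1)\le\dots\le\deg(t_\mu)$, and let $\partial\mathcal O=(x_1\mathcal O\cup\dots\cup x_n\mathcal O)\setminus\mathcal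 O=\{b_1,\dots,b_\nu\}$ be its border, with $b_1,\dots,b_\nu$ distinct. An *$\mathcal O$-border prebasis* is a tuple of polynomials $(h_1,\dots,h_\nu)$ of the form $h_j=b_j-\sum_{i=1}^{\mu}\gamma_{ij}t_i$ with $\gamma_{ij}\in K$; it is an *$\mathcal O$-border basis* of an ideal $J$ if $h_1,\dots,h_\nu\in J$ and the residue classes of $t_1,\dots,t_\mu$ form a $K$-basis of $P/J$. Let $G=(g_1,\dots,g_\nu)$ be an $\mathcal O$-border prebasis with $g_1,\dots,g_\nu\in I$. Then the following conditions are equivalent. (a) The terms of $\mathcal O$ form a degree filtered $K$-basis of $R$, compatibly with degrees; that is, the tuple of residue classes $(\bar t_1,\dots,\bar t_\mu)$ is a degree filtered $K$-basis of $R$, and $\mathrm{ord}(\bar t_j)=\deg(t_j)$ for all $j$. (b) The residue classes of $t_1,\dots,t_\mu$ form a $K$-basis of $P/\mathrm{DF}(I)$. (c) The ideal $I$ has an $\mathcal O$-border basis, and $\mathrm{HF}^a(i)=\#\{j\in\{1,\dots,\mu\}\mid \deg(t_j)\le i\}$ for all integers $i\ge 0$. (d) The ideal $I$ has an $\mathcal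 O$-border basis, and for $j=1,\dots,\nu$ the term $b_j$ occurs in $\mathrm{DF}(g_j)$ with nonzero coefficient. (e) The tuple $(\mathrm{DF}(g_1),\dots,\mathrm{DF}(g_\nu))$ is an $\mathcal O$-border basis of $\mathrm{DF}(I)$. Moreover, if (e) holds, then $\mathrm{DF}(g_1),\dots,\mathrm{DF}(g_\nu)$ generate the ideal $\mathrm{DF}(I)$. -/

import Mathlib

namespace BorderBasis

open MvPolynomial

section

variable {K : Type*} [Field K] {n : ℕ}

/-- The degree filtration on `P = K[x₁, …, xₙ]`: for `i : ℤ`, the subspace `F_i P` of `P` consisting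
of `0` and of all polynomials of degree at most `i`. In particular `F_i P = 0` for `i < 0`. -/
def filtP (K : Type*) [Field K] (n : ℕ) (i : ℤ) : Submodule K (MvPolynomial (Fin n) K) where
  carrier := {f | f = 0 ∨ (f.totalDegree : ℤ) ≤ i}
  zero_mem' := Or.inl rfl
  add_mem' := by
    rintro f g (rfl | hf) (rfl | hg)
    · left; simp
    · right; simpa using hg
    · right; simpa using hf
    · right
      have h := totalDegree_add f g
      rcases le_total f.totalDegree g.totalDegree with h' | h'
      · rw [max_eq_right h'] at h; omega
      · rw [max_eq_left h'] at h; omega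
  smul_mem' := by
    rintro c f (rfl | hf)
    · left; simp
    · right
      have h := totalDegree_smul_le c f
      omega

/-- The induced degree filtration on `R = P / I`: the image of `F_i P` in `R`,
i.e. `F_i R = F_i P / (F_i P ∩ I)`. -/
noncomputable def filtR (I : Ideal (MvPolynomial (Fin n) K)) (i : ℤ) :
    Submodule K (MvPolynomial (Fin n) K ⧸ I) :=
  (filtP K n i).map (Ideal.Quotient.mkₐ K I).toLinearMap

/-- The order of a nonzero element `f` of `R = P / I` with respect to the degree filtration:
the (unique) integer `i` with `f ∈ F_i R` and `f ∉ F_{i-1} R`. (The value at `f = 0` is junk.) -/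
noncomputable def ord (I : Ideal (MvPolynomial (Fin n) K)) (f : MvPolynomial (Fin n) K ⧸ I) : ℤ :=
  sInf {i : ℤ | f ∈ filtR I i ∧ f ∉ filtR I (i - 1)}

/-- The affine Hilbert function `i ↦ dim_K (F_i R)` of `R = P / I`. -/
noncomputable def affineHilbert (I : Ideal (MvPolynomial (Fin n) K)) (i : ℤ) : ℕ :=
  Module.finrank K (filtR I i)

/-- A finite tuple of elements is a `K`-basis of the subspace `W` of `V`. -/
def IsBasisOf {V : Type*} [AddCommGroup V] [Module K V] {ι : Type*} (v : ι → V)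
    (W : Submodule K V) : Prop :=
  LinearIndependent K v ∧ Submodule.span K (Set.range v) = W

/-- A tuple `B` in `R = P / I` is a degree filtered `K`-basis of `R`: for every `i : ℤ` the members of
`B` which lie in `F_i R` form a `K`-basis of `F_i R`, and the orders of the members of `B` are
weakly increasing. -/
def IsDegreeFilteredBasis (I : Ideal (MvPolynomial (Fin n) K)) {m : ℕ}
    (B : Fin m → MvPolynomial (Fin n) K ⧸ I) : Prop :=
  (∀ i : ℤ, IsBasisOf (fun j : {j : Fin m // B j ∈ filtR I i} => B j) (filtR I i)) ∧
    Monotone fun j => ord I (B j)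

/-- The degree form of `f`, its homogeneous component of highest degree (and `0` for `f = 0`). -/
noncomputable def degreeForm (f : MvPolynomial (Fin n) K) : MvPolynomial (Fin n) K :=
  homogeneousComponent f.totalDegree f

/-- The degree form ideal of `I`, generated by the degree forms of the nonzero elements of `I`. -/
noncomputable def degreeFormIdeal (I : Ideal (MvPolynomial (Fin n) K)) :
    Ideal (MvPolynomial (Fin n) K) :=
  Ideal.span {h | ∃ f ∈ I, f ≠ 0 ∧ degreeForm f = h}

/-- The term `x₁^{a₁} ⋯ xₙ^{aₙ}` of `P` with exponent vector `a`. -/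
noncomputable def term (K : Type*) [Field K] {n : ℕ} (a : Fin n →₀ ℕ) : MvPolynomial (Fin n) K :=
  monomial a 1

/-- A set of terms (given by exponent vectors) is an order ideal if it contains with each term all
its divisors. Divisibility of terms is the componentwise order of exponent vectors. -/
def IsOrderIdeal (O : Set (Fin n →₀ ℕ)) : Prop :=
  ∀ a ∈ O, ∀ c, c ≤ a → c ∈ O

/-- The border `(x₁ O ∪ ⋯ ∪ xₙ O) \ O` of a set `O` of terms. -/
def border (O : Set (Fin n →₀ ℕ)) : Set (Fin n →₀ ℕ) :=
  {c | ∃ a ∈ O, ∃ k : Fin n, c = a + Finsupp.single k 1} \ O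

/-- For `O = {t₁, …, t_μ}` with border `{b₁, …, b_ν}`: the tuple `g` is an `O`-border prebasis,
i.e. `g_j = b_j - ∑ i, γ_{ij} t_i` with coefficients `γ_{ij}` in `K`. -/
def IsBorderPrebasis {μ ν : ℕ} (t : Fin μ → Fin n →₀ ℕ) (b : Fin ν → Fin n →₀ ℕ)
    (g : Fin ν → MvPolynomial (Fin n) K) : Prop :=
  ∃ γ : Fin μ → Fin ν → K, ∀ j, g j = term K (b j) - ∑ i, γ i j • term K (t i)

/-- The residue classes in `P / J` of the terms `t₁, …, t_μ`. -/
noncomputable def residues (J : Ideal (MvPolynomial (Fin n) K)) {μ : ℕ} (t : Fin μ → Fin n →₀ ℕ) :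
    Fin μ → MvPolynomial (Fin n) K ⧸ J :=
  fun i => Ideal.Quotient.mk J (term K (t i))

/-- For `O = {t₁, …, t_μ}` with border `{b₁, …, b_ν}`: the tuple `g` is an `O`-border basis of the
ideal `J`, i.e. it is an `O`-border prebasis contained in `J`, and the residue classes of the terms
of `O` form a `K`-basis of `P / J`. -/
def IsBorderBasis (J : Ideal (MvPolynomial (Fin n) K)) {μ ν : ℕ} (t : Fin μ → Fin n →₀ ℕ)
    (b : Fin ν → Fin n →₀ ℕ) (g : Fin ν → MvPolynomial (Fin n) K) : Prop :=
  IsBorderPrebasis t b g ∧ (∀ j, g j ∈ J) ∧ IsBasisOf (residues J t) (⊤ : Submodule K _)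

end

end BorderBasis

/-!
# Border bases and the degree filtration

All five conditions are equivalent to one statement about `I` itself, `IsDegreeCompatible I t`: the
terms of `O` are linearly independent modulo `I`, and every polynomial of degree at most `i` is
congruent modulo `I` to a combination of terms of `O` of degree at most `i`. In other words,
`F_i R` has the residues of the terms of `O` of degree at most `i` as a basis, for every `i`.

* For degree filtered bases this is a reformulation, as the residue of `t_j` then lies in `F_i R`
  exactly when `deg t_j ≤ i` (`isDegreeCompatible_iff_isDegreeFilteredBasis`). For the affine
  Hilbert function it is a dimension count, since the terms of degree at most `i` always lie in
  `F_i R` (`isDegreeCompatible_iff_affineHilbert`).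
* The ideal `DF(I)` consists, degree by degree, of the degree `d` components of elements of `I` of
  degree at most `d` (`exists_homogeneousComponent_eq`). Thus a reduction modulo `DF(I)` of a
  polynomial of degree `d` lifts to a reduction modulo `I` up to an error of smaller degree, and
  conversely a reduction modulo `I` that does not raise the degree has a leading part which is a
  reduction modulo `DF(I)` (`isDegreeCompatible_iff_degreeFormIdeal`).
* If `b_j` occurs in `DF(g_j)`, then `g_j` rewrites `b_j` without raising the degree, and iterating
  this rewriting reduces every polynomial without raising its degree (`filtP_le_degSpan_sup`).
  Conversely, in the degree compatible case the coefficients of `g_j` are determined by linear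
  independence, so they vanish on the terms of degree larger than `deg b_j`
  (`IsDegreeCompatible.degree_le_border`). This also shows that the `DF(g_j)` form a border
  prebasis.

The same rewriting, modulo the ideal generated by the `DF(g_j)`, shows that these generate `DF(I)`
(`span_degreeForm_eq`).
-/

namespace BorderBasis

open MvPolynomial

variable {K : Type*} [Field K] {n μ ν : ℕ}

/-! ### The degree filtration on polynomials -/

theorem mem_filtP_iff {i : ℤ} {f : MvPolynomial (Fin n) K} :
    f ∈ filtP K n i ↔ ∀ m, coeff m f ≠ 0 → (m.degree : ℤ) ≤ i := by
  change (f = 0 ∨ (f.totalDegree : ℤ) ≤ i) ↔ _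
  constructor
  · rintro (rfl | h) m hm
    · simp at hm
    · have h' := le_totalDegree (mem_support_iff.2 hm)
      change m.degree ≤ _ at h'
      omega
  · intro h
    rcases eq_or_ne f 0 with h0 | h0
    · exact Or.inl h0
    · obtain ⟨m, hm, hmd⟩ := f.support.exists_mem_eq_sup (support_nonempty.2 h0)
        (fun s => s.sum fun _ e => e)
      right
      have h1 : f.totalDegree = m.degree := hmd
      rw [h1]
      exact h m (mem_support_iff.1 hm)

theorem filtP_eq_bot {i : ℤ} (hi : i < 0) : filtP K n i = ⊥ := by
  refine (Submodule.eq_bot_iff _).2 fun f hf => ?_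
  ext m
  by_contra h
  have := mem_filtP_iff.1 hf m (by simpa using h)
  omega

theorem mem_filtP_totalDegree (f : MvPolynomial (Fin n) K) : f ∈ filtP K n f.totalDegree :=
  Or.inr le_rfl

theorem coeff_term (a m : Fin n →₀ ℕ) : coeff m (term K a) = if a = m then 1 else 0 := by
  classical
  simp [term, coeff_monomial]

theorem term_mem_filtP {a : Fin n →₀ ℕ} {i : ℤ} (h : (a.degree : ℤ) ≤ i) :
    term K a ∈ filtP K n i := by
  refine mem_filtP_iff.2 fun m hm => ?_
  rw [coeff_term] at hm
  split_ifs at hm with h'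
  · rwa [← h']
  · exact absurd rfl hm

theorem filtP_le_of_term_mem {i : ℤ} {W : Submodule K (MvPolynomial (Fin n) K)}
    (h : ∀ a : Fin n →₀ ℕ, (a.degree : ℤ) ≤ i → term K a ∈ W) : filtP K n i ≤ W := by
  intro f hf
  rw [f.as_sum]
  refine Submodule.sum_mem _ fun m hm => ?_
  have : monomial m (coeff m f) = coeff m f • term K m := by simp [term, smul_monomial]
  rw [this]
  exact W.smul_mem _ (h m (mem_filtP_iff.1 hf m (mem_support_iff.1 hm)))

theorem mem_filtP_sub_one {d : ℕ} {f : MvPolynomial (Fin n) K} (hf : f ∈ filtP K n d)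
    (h0 : homogeneousComponent d f = 0) : f ∈ filtP K n (d - 1) := by
  refine mem_filtP_iff.2 fun m hm => ?_
  have h1 := mem_filtP_iff.1 hf m hm
  have h2 : m.degree ≠ d := by
    intro h
    have := coeff_homogeneousComponent d f m
    rw [h0, if_pos h] at this
    exact hm (by simpa using this.symm)
  omega

/-! ### Linear combinations of terms -/

/-- The linear combination of the terms `t₁, …, t_μ` with coefficient tuple `c`. -/
noncomputable def termSum (t : Fin μ → Fin n →₀ ℕ) (c : Fin μ → K) : MvPolynomial (Fin n) K :=
  ∑ i, c i • term K (t i)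

theorem termSum_sub (t : Fin μ → Fin n →₀ ℕ) (c c' : Fin μ → K) :
    termSum t (c - c') = termSum t c - termSum t c' := by
  simp [termSum, sub_smul]

theorem coeff_termSum {t : Fin μ → Fin n →₀ ℕ} (ht : Function.Injective t) (c : Fin μ → K)
    (j : Fin μ) : coeff (t j) (termSum t c) = c j := by
  simp [termSum, coeff_sum, coeff_term, ht.eq_iff]

theorem coeff_termSum_of_notMem {t : Fin μ → Fin n →₀ ℕ} (c : Fin μ → K) {m : Fin n →₀ ℕ}
    (hm : m ∉ Set.range t) : coeff m (termSum t c) = 0 := by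
  rw [termSum, coeff_sum]
  refine Finset.sum_eq_zero fun j _ => ?_
  have : t j ≠ m := fun h => hm ⟨j, h⟩
  simp [coeff_term, this]

theorem homogeneousComponent_term (d : ℕ) (a : Fin n →₀ ℕ) :
    homogeneousComponent d (term K a) = if a.degree = d then term K a else 0 := by
  ext m
  rw [coeff_homogeneousComponent, coeff_term]
  by_cases h : a = m
  · subst h
    by_cases h' : a.degree = d <;> simp [coeff_term, h']
  · split_ifs <;> simp [coeff_term, h]

theorem homogeneousComponent_termSum (d : ℕ) (t : Fin μ → Fin n →₀ ℕ) (c : Fin μ → K) :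
    homogeneousComponent d (termSum t c) =
      termSum t fun j => if (t j).degree = d then c j else 0 := by
  simp only [termSum, map_sum, map_smul, homogeneousComponent_term]
  refine Finset.sum_congr rfl fun j _ => ?_
  split_ifs <;> simp

/-- The subspace of `P` spanned by those terms among `t₁, …, t_μ` that have degree at most `i`. -/
noncomputable def degSpan (K : Type*) [Field K] (t : Fin μ → Fin n →₀ ℕ) (i : ℤ) :
    Submodule K (MvPolynomial (Fin n) K) :=
  Submodule.span K (Set.range fun j : {j : Fin μ // ((t j).degree : ℤ) ≤ i} => term K (t j))

theorem term_mem_degSpan {t : Fin μ → Fin n →₀ ℕ} {i : ℤ} {j : Fin μ}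
    (h : ((t j).degree : ℤ) ≤ i) : term K (t j) ∈ degSpan K t i :=
  Submodule.subset_span ⟨⟨j, h⟩, rfl⟩

theorem degSpan_le_iff {t : Fin μ → Fin n →₀ ℕ} {i : ℤ}
    {W : Submodule K (MvPolynomial (Fin n) K)} :
    degSpan K t i ≤ W ↔ ∀ j, ((t j).degree : ℤ) ≤ i → term K (t j) ∈ W := by
  rw [degSpan, Submodule.span_le]
  constructor
  · intro h j hj
    exact h ⟨⟨j, hj⟩, rfl⟩
  · rintro h _ ⟨⟨j, hj⟩, rfl⟩
    exact h j hj

theorem degSpan_mono {t : Fin μ → Fin n →₀ ℕ} {i i' : ℤ} (h : i ≤ i') :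
    degSpan K t i ≤ degSpan K t i' :=
  degSpan_le_iff.2 fun _ hj => term_mem_degSpan (hj.trans h)

theorem degSpan_le_filtP (t : Fin μ → Fin n →₀ ℕ) (i : ℤ) : degSpan K t i ≤ filtP K n i :=
  degSpan_le_iff.2 fun _ hj => term_mem_filtP hj

theorem termSum_mem_degSpan {t : Fin μ → Fin n →₀ ℕ} {i : ℤ} {c : Fin μ → K}
    (h : ∀ j, c j ≠ 0 → ((t j).degree : ℤ) ≤ i) : termSum t c ∈ degSpan K t i := by
  refine Submodule.sum_mem _ fun j _ => ?_
  by_cases hc : c j = 0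
  · simp [hc]
  · exact Submodule.smul_mem _ _ (term_mem_degSpan (h j hc))

theorem exists_termSum_eq_of_mem_degSpan {t : Fin μ → Fin n →₀ ℕ} (ht : Function.Injective t)
    {i : ℤ} {f : MvPolynomial (Fin n) K} (hf : f ∈ degSpan K t i) :
    ∃ c : Fin μ → K, (∀ j, c j ≠ 0 → ((t j).degree : ℤ) ≤ i) ∧ termSum t c = f := by
  have hf' : f ∈ Submodule.span K (Set.range fun j => term K (t j)) := by
    refine Submodule.span_mono ?_ hf
    rintro _ ⟨j, rfl⟩
    exact ⟨j, rfl⟩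
  obtain ⟨c, rfl⟩ := (Submodule.mem_span_range_iff_exists_fun K).1 hf'
  refine ⟨c, fun j hj => ?_, rfl⟩
  refine mem_filtP_iff.1 (degSpan_le_filtP t i hf) (t j) ?_
  rwa [show (∑ i, c i • term K (t i)) = termSum t c from rfl, coeff_termSum ht]

/-! ### Residue classes of terms -/

theorem ker_mk (J : Ideal (MvPolynomial (Fin n) K)) :
    LinearMap.ker (Ideal.Quotient.mkₐ K J).toLinearMap = J.restrictScalars K := by
  ext f
  simp [Ideal.Quotient.eq_zero_iff_mem]

theorem sum_residues (J : Ideal (MvPolynomial (Fin n) K)) (t : Fin μ → Fin n →₀ ℕ)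
    (c : Fin μ → K) :
    ∑ j, c j • residues J t j = (Ideal.Quotient.mkₐ K J).toLinearMap (termSum t c) := by
  simp only [termSum, map_sum, map_smul]
  rfl

theorem linearIndependent_residues_iff {J : Ideal (MvPolynomial (Fin n) K)}
    {t : Fin μ → Fin n →₀ ℕ} :
    LinearIndependent K (residues J t) ↔ ∀ c, termSum t c ∈ J → c = 0 := by
  rw [Fintype.linearIndependent_iff]
  refine forall_congr' fun c => ?_
  rw [sum_residues, ← LinearMap.mem_ker, ker_mk, Submodule.restrictScalars_mem, funext_iff]
  rfl

theorem isBasisOf_residues_iff {J : Ideal (MvPolynomial (Fin n) K)} {t : Fin μ → Fin n →₀ ℕ} :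
    IsBasisOf (residues J t) (⊤ : Submodule K _) ↔
      (∀ c : Fin μ → K, termSum t c ∈ J → c = 0) ∧ ∀ f, ∃ c : Fin μ → K, f - termSum t c ∈ J := by
  rw [IsBasisOf, linearIndependent_residues_iff]
  refine and_congr_right fun _ => ?_
  rw [Submodule.eq_top_iff', (Ideal.Quotient.mk_surjective (I := J)).forall]
  refine forall_congr' fun f => ?_
  rw [Submodule.mem_span_range_iff_exists_fun]
  refine exists_congr fun c => ?_
  rw [sum_residues, ← Ideal.Quotient.eq, eq_comm]
  rfl

/-- The common form of all five conditions: the terms `t₁, …, t_μ` are linearly independent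
modulo `J`, and modulo `J` every polynomial of degree at most `i` is a linear combination of those
`t_j` of degree at most `i`. For `i < 0` the second condition is vacuous. -/
structure IsDegreeCompatible (J : Ideal (MvPolynomial (Fin n) K)) (t : Fin μ → Fin n →₀ ℕ) :
    Prop where
  eq_zero_of_mem : ∀ c : Fin μ → K, termSum t c ∈ J → c = 0
  filtP_le : ∀ i : ℤ, filtP K n i ≤ degSpan K t i ⊔ J.restrictScalars K

theorem exists_sub_termSum_mem {J : Ideal (MvPolynomial (Fin n) K)} {t : Fin μ → Fin n →₀ ℕ}
    (ht : Function.Injective t) {i : ℤ} {f : MvPolynomial (Fin n) K}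
    (hf : f ∈ degSpan K t i ⊔ J.restrictScalars K) :
    ∃ c : Fin μ → K, (∀ j, c j ≠ 0 → ((t j).degree : ℤ) ≤ i) ∧ f - termSum t c ∈ J := by
  obtain ⟨x, hx, y, hy, rfl⟩ := Submodule.mem_sup.1 hf
  obtain ⟨c, hc, rfl⟩ := exists_termSum_eq_of_mem_degSpan ht hx
  exact ⟨c, hc, by simpa using hy⟩

theorem IsDegreeCompatible.isBasisOf {J : Ideal (MvPolynomial (Fin n) K)}
    {t : Fin μ → Fin n →₀ ℕ} (h : IsDegreeCompatible J t) (ht : Function.Injective t) :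
    IsBasisOf (residues J t) (⊤ : Submodule K _) := by
  refine isBasisOf_residues_iff.2 ⟨h.eq_zero_of_mem, fun f => ?_⟩
  obtain ⟨c, -, hc⟩ := exists_sub_termSum_mem ht (h.filtP_le _ (mem_filtP_totalDegree f))
  exact ⟨c, hc⟩

theorem zero_mem_range {J : Ideal (MvPolynomial (Fin n) K)} (hJ : J ≠ ⊤)
    {t : Fin μ → Fin n →₀ ℕ} (hO : IsOrderIdeal (Set.range t))
    (h : IsBasisOf (residues J t) (⊤ : Submodule K _)) : 0 ∈ Set.range t := by
  rcases isEmpty_or_nonempty (Fin μ) with hμ | ⟨⟨j⟩⟩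
  · obtain ⟨c, hc⟩ := (isBasisOf_residues_iff.1 h).2 1
    refine absurd ((Ideal.eq_top_iff_one J).2 ?_) hJ
    simpa [termSum] using hc
  · exact hO (t j) ⟨j, rfl⟩ 0 zero_le

/-! ### The degree form ideal -/

theorem homogeneousComponent_mem_degreeFormIdeal {I : Ideal (MvPolynomial (Fin n) K)} {d : ℕ}
    {f : MvPolynomial (Fin n) K} (hf : f ∈ I) (hd : f ∈ filtP K n d) :
    homogeneousComponent d f ∈ degreeFormIdeal I := by
  rcases hd with rfl | hd
  · simp
  · rcases (Int.ofNat_le.1 hd).lt_or_eq with h | rfl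
    · rw [homogeneousComponent_eq_zero _ _ h]
      exact zero_mem _
    · rcases eq_or_ne f 0 with rfl | h0
      · simp
      · exact Ideal.subset_span ⟨f, hf, h0, rfl⟩

theorem degreeForm_mem_degreeFormIdeal {I : Ideal (MvPolynomial (Fin n) K)}
    {f : MvPolynomial (Fin n) K} (hf : f ∈ I) : degreeForm f ∈ degreeFormIdeal I :=
  homogeneousComponent_mem_degreeFormIdeal hf (mem_filtP_totalDegree f)

theorem homogeneousComponent_monomial_mul (d : ℕ) (a : Fin n →₀ ℕ) (r : K)
    (f : MvPolynomial (Fin n) K) :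
    homogeneousComponent d (monomial a r * f) =
      if a.degree ≤ d then monomial a r * homogeneousComponent (d - a.degree) f else 0 := by
  ext m
  rw [coeff_homogeneousComponent, coeff_monomial_mul']
  by_cases ham : a ≤ m
  · obtain ⟨m', rfl⟩ := exists_add_of_le ham
    have hdeg : (a + m').degree = a.degree + m'.degree := map_add _ _ _
    rw [if_pos ham, hdeg, add_tsub_cancel_left]
    by_cases h : a.degree ≤ d
    · rw [if_pos h, coeff_monomial_mul, coeff_homogeneousComponent]
      by_cases h' : a.degree + m'.degree = d
      · rw [if_pos h', if_pos (by omega)]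
      · rw [if_neg h', if_neg (by omega), mul_zero]
    · rw [if_neg h, if_neg (by omega), coeff_zero]
  · split_ifs <;> simp [coeff_monomial_mul', ham]

/-- Every homogeneous component of an element of the degree form ideal is the leading component of
an element of `I`: the converse of `homogeneousComponent_mem_degreeFormIdeal`. -/
theorem exists_homogeneousComponent_eq {I : Ideal (MvPolynomial (Fin n) K)}
    {h : MvPolynomial (Fin n) K} (hh : h ∈ degreeFormIdeal I) (d : ℕ) :
    ∃ f ∈ I, f ∈ filtP K n d ∧ homogeneousComponent d f = homogeneousComponent d h := by
  induction hh using Submodule.span_induction generalizing d with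
  | mem x hx =>
    obtain ⟨f, hf, -, rfl⟩ := hx
    by_cases hd : d = f.totalDegree
    · subst hd
      refine ⟨f, hf, mem_filtP_totalDegree f, ?_⟩
      rw [degreeForm, homogeneousComponent_eq_self (homogeneousComponent_isHomogeneous _ _)]
    · refine ⟨0, zero_mem _, zero_mem _, ?_⟩
      rw [degreeForm, homogeneousComponent_of_mem (homogeneousComponent_mem _ _), if_neg hd,
        map_zero]
  | zero => exact ⟨0, zero_mem _, zero_mem _, rfl⟩
  | add x y _ _ hx hy =>
    obtain ⟨f, hf, hfd, hfx⟩ := hx d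
    obtain ⟨f', hf', hfd', hfy⟩ := hy d
    exact ⟨f + f', add_mem hf hf', add_mem hfd hfd', by rw [map_add, map_add, hfx, hfy]⟩
  | smul p x _ hx =>
    simp only [smul_eq_mul]
    induction p using MvPolynomial.induction_on' with
    | monomial a r =>
      by_cases had : a.degree ≤ d
      · obtain ⟨f, hf, hfd, hfx⟩ := hx (d - a.degree)
        refine ⟨monomial a r * f, I.mul_mem_left _ hf, ?_, ?_⟩
        · refine mem_filtP_iff.2 fun m hm => ?_
          rw [coeff_monomial_mul'] at hm
          by_cases ham : a ≤ m
          · obtain ⟨m', rfl⟩ := exists_add_of_le ham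
            rw [if_pos ham, add_tsub_cancel_left] at hm
            have h1 := mem_filtP_iff.1 hfd m' (right_ne_zero_of_mul hm)
            have hdeg : (a + m').degree = a.degree + m'.degree := map_add _ _ _
            omega
          · exact absurd (if_neg ham) hm
        · rw [homogeneousComponent_monomial_mul, homogeneousComponent_monomial_mul, if_pos had,
            if_pos had, hfx]
      · refine ⟨0, zero_mem _, zero_mem _, ?_⟩
        rw [homogeneousComponent_monomial_mul, if_neg had, map_zero]
    | add p q hp hq =>
      obtain ⟨f, hf, hfd, hfx⟩ := hp
      obtain ⟨f', hf', hfd', hfy⟩ := hq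
      exact ⟨f + f', add_mem hf hf', add_mem hfd hfd', by
        rw [add_mul, map_add, map_add, hfx, hfy]⟩

/-- The part of degree `d` of a coefficient tuple, all other coefficients being set to zero. -/
noncomputable def degPart (t : Fin μ → Fin n →₀ ℕ) (d : ℕ) (c : Fin μ → K) : Fin μ → K :=
  fun j => if (t j).degree = d then c j else 0

theorem termSum_degPart (t : Fin μ → Fin n →₀ ℕ) (d : ℕ) (c : Fin μ → K) :
    termSum t (degPart t d c) = homogeneousComponent d (termSum t c) :=
  (homogeneousComponent_termSum d t c).symm

theorem eq_zero_of_degPart_eq_zero {t : Fin μ → Fin n →₀ ℕ} {c : Fin μ → K}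
    (h : ∀ d, degPart t d c = 0) : c = 0 := by
  funext j
  have := congrFun (h (t j).degree) j
  simpa [degPart] using this

theorem degree_eq_of_degPart_ne_zero {t : Fin μ → Fin n →₀ ℕ} {d : ℕ} {c : Fin μ → K} {j : Fin μ}
    (h : degPart t d c j ≠ 0) : (t j).degree = d := by
  by_contra h'
  exact h (if_neg h')

theorem homogeneousComponent_degPart (t : Fin μ → Fin n →₀ ℕ) (d : ℕ) (c : Fin μ → K) :
    homogeneousComponent d (termSum t (degPart t d c)) = termSum t (degPart t d c) := by
  rw [termSum_degPart]
  exact homogeneousComponent_eq_self (homogeneousComponent_isHomogeneous _ _)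

theorem isDegreeCompatible_iff_degreeFormIdeal {I : Ideal (MvPolynomial (Fin n) K)}
    {t : Fin μ → Fin n →₀ ℕ} (ht : Function.Injective t) :
    IsDegreeCompatible I t ↔
      IsBasisOf (residues (degreeFormIdeal I) t) (⊤ : Submodule K _) := by
  constructor
  · refine fun h => isBasisOf_residues_iff.2 ⟨fun c hc => ?_, fun f => ?_⟩
    · refine eq_zero_of_degPart_eq_zero (t := t) fun d => ?_
      -- The degree `d` part of the relation lifts to `I`; its lower terms reduce to terms of
      -- degree `< d`, which cannot cancel against terms of degree `d`.
      obtain ⟨f, hfI, hfd, hf⟩ := exists_homogeneousComponent_eq hc d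
      rw [← termSum_degPart] at hf
      have hlow : termSum t (degPart t d c) - f ∈ filtP K n (d - 1) := by
        refine mem_filtP_sub_one (sub_mem ?_ hfd) ?_
        · refine degSpan_le_filtP t _ (termSum_mem_degSpan fun j hj => ?_)
          rw [degree_eq_of_degPart_ne_zero hj]
        · rw [map_sub, hf, homogeneousComponent_degPart, sub_self]
      obtain ⟨e, he, heI⟩ := exists_sub_termSum_mem ht (h.filtP_le _ hlow)
      have h0 : degPart t d c - e = 0 := by
        refine h.eq_zero_of_mem _ ?_
        rw [termSum_sub]
        convert add_mem heI hfI using 1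
        ring
      funext j
      by_contra hj
      have hdj := degree_eq_of_degPart_ne_zero hj
      have hej := he j (by rw [← sub_eq_zero.1 h0]; exact hj)
      omega
    · have key : (⊤ : Submodule K (MvPolynomial (Fin n) K)) ≤
          Submodule.span K (Set.range fun j => term K (t j)) ⊔
            (degreeFormIdeal I).restrictScalars K := by
        have hterm : ∀ a : Fin n →₀ ℕ, term K a ∈
            Submodule.span K (Set.range fun j => term K (t j)) ⊔
              (degreeFormIdeal I).restrictScalars K := by
          intro a
          obtain ⟨c, hc, hcI⟩ := exists_sub_termSum_mem ht
            (h.filtP_le _ (term_mem_filtP (K := K) (le_refl (a.degree : ℤ))))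
          have h1 := homogeneousComponent_mem_degreeFormIdeal hcI (d := a.degree)
            (sub_mem (term_mem_filtP le_rfl)
              (degSpan_le_filtP t _ (termSum_mem_degSpan hc)))
          rw [map_sub, homogeneousComponent_term, if_pos rfl, ← termSum_degPart] at h1
          rw [← add_sub_cancel (termSum t (degPart t a.degree c)) (term K a)]
          exact Submodule.add_mem_sup
            ((Submodule.mem_span_range_iff_exists_fun K).2 ⟨_, rfl⟩) h1
        intro f _
        exact filtP_le_of_term_mem (fun a _ => hterm a) (mem_filtP_totalDegree f)
      obtain ⟨x, hx, y, hy, rfl⟩ := Submodule.mem_sup.1 (key (Submodule.mem_top (x := f)))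
      obtain ⟨c, rfl⟩ := (Submodule.mem_span_range_iff_exists_fun K).1 hx
      exact ⟨c, by simpa [termSum] using hy⟩
  · intro h
    obtain ⟨hli, hspan⟩ := isBasisOf_residues_iff.1 h
    refine ⟨fun c hc => ?_, ?_⟩
    · by_contra hne
      -- The degree form of a nontrivial relation is a nontrivial relation modulo `DF(I)`.
      have hdf := hli (degPart t (termSum t c).totalDegree c) (by
        rw [termSum_degPart]
        exact degreeForm_mem_degreeFormIdeal hc)
      have h0 : termSum t c ≠ 0 := fun h0 => hne (by
        funext j
        rw [← coeff_termSum ht c j, h0]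
        simp)
      obtain ⟨m, hm, hmd⟩ := (termSum t c).support.exists_mem_eq_sup (support_nonempty.2 h0)
        (fun s => s.sum fun _ e => e)
      have hmd' : (termSum t c).totalDegree = m.degree := hmd
      have hmt : m ∈ Set.range t := by
        by_contra hmt
        exact (mem_support_iff.1 hm) (coeff_termSum_of_notMem c hmt)
      obtain ⟨j, rfl⟩ := hmt
      rw [mem_support_iff, coeff_termSum ht] at hm
      have := congrFun hdf j
      rw [degPart, if_pos hmd'.symm] at this
      exact hm this
    · intro i
      rcases lt_or_ge i 0 with hi | hi
      · rw [filtP_eq_bot hi]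
        exact bot_le
      · -- Each step lowers the degree by one, after subtracting terms and an element of `I`.
        have step : ∀ d : ℕ, filtP K n ((d : ℤ) - 1) ≤
              degSpan K t ((d : ℤ) - 1) ⊔ I.restrictScalars K →
            filtP K n d ≤ degSpan K t d ⊔ I.restrictScalars K := by
          intro d ih f hf
          obtain ⟨c, hc⟩ := hspan f
          obtain ⟨q, hqI, hqd, hq⟩ := exists_homogeneousComponent_eq hc d
          have hs : termSum t (degPart t d c) ∈ degSpan K t d := termSum_mem_degSpan fun j hj => by
            rw [degree_eq_of_degPart_ne_zero hj]
          have hlow : f - termSum t (degPart t d c) - q ∈ filtP K n (d - 1) := by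
            refine mem_filtP_sub_one (sub_mem (sub_mem hf (degSpan_le_filtP t _ hs)) hqd) ?_
            rw [map_sub, map_sub, hq, homogeneousComponent_degPart, map_sub, termSum_degPart,
              sub_self]
          have h1 := sup_le_sup_right (degSpan_mono (K := K) (t := t) (sub_one_lt (d : ℤ)).le)
            (I.restrictScalars K) (ih hlow)
          have h2 := add_mem h1 (Submodule.add_mem_sup hs (show q ∈ I.restrictScalars K from hqI))
          convert h2 using 1
          ring
        lift i to ℕ using hi
        induction i with
        | zero =>
          refine step 0 ?_
          rw [filtP_eq_bot (by simp)]
          exact bot_le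
        | succ d ih => exact step (d + 1) (by simpa using ih)

/-! ### The induced filtration on the quotient -/

theorem filtR_le_map_iff {J : Ideal (MvPolynomial (Fin n) K)}
    {W : Submodule K (MvPolynomial (Fin n) K)} {i : ℤ} :
    filtR J i ≤ W.map (Ideal.Quotient.mkₐ K J).toLinearMap ↔
      filtP K n i ≤ W ⊔ J.restrictScalars K := by
  rw [filtR, Submodule.map_le_iff_le_comap, Submodule.comap_map_eq, ker_mk]

theorem map_degSpan (J : Ideal (MvPolynomial (Fin n) K)) (t : Fin μ → Fin n →₀ ℕ) (i : ℤ) :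
    (degSpan K t i).map (Ideal.Quotient.mkₐ K J).toLinearMap =
      Submodule.span K
        (Set.range fun j : {j : Fin μ // ((t j).degree : ℤ) ≤ i} => residues J t j) := by
  rw [degSpan, Submodule.map_span, ← Set.range_comp]
  rfl

theorem map_degSpan_le_filtR (J : Ideal (MvPolynomial (Fin n) K)) (t : Fin μ → Fin n →₀ ℕ)
    (i : ℤ) : (degSpan K t i).map (Ideal.Quotient.mkₐ K J).toLinearMap ≤ filtR J i :=
  Submodule.map_mono (degSpan_le_filtP t i)

theorem residues_mem_filtR {J : Ideal (MvPolynomial (Fin n) K)} {t : Fin μ → Fin n →₀ ℕ}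
    {j : Fin μ} {i : ℤ} (h : ((t j).degree : ℤ) ≤ i) : residues J t j ∈ filtR J i :=
  ⟨term K (t j), term_mem_filtP h, rfl⟩

theorem filtR_eq_bot (J : Ideal (MvPolynomial (Fin n) K)) {i : ℤ} (hi : i < 0) :
    filtR J i = ⊥ := by
  rw [filtR, filtP_eq_bot hi, Submodule.map_bot]

theorem ord_le_of_mem_filtR {J : Ideal (MvPolynomial (Fin n) K)} {f : MvPolynomial (Fin n) K ⧸ J}
    (h0 : f ≠ 0) {i : ℤ} (hf : f ∈ filtR J i) : ord J f ≤ i := by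
  have hbdd : ∀ z, f ∈ filtR J z → 0 ≤ z := by
    intro z hz
    by_contra hneg
    rw [filtR_eq_bot J (not_le.1 hneg), Submodule.mem_bot] at hz
    exact h0 hz
  obtain ⟨z, hz, hmin⟩ := Int.exists_least_of_bdd ⟨0, hbdd⟩ ⟨i, hf⟩
  have hset : z ∈ {i : ℤ | f ∈ filtR J i ∧ f ∉ filtR J (i - 1)} :=
    ⟨hz, fun h => by have := hmin _ h; omega⟩
  exact (csInf_le ⟨0, fun y hy => hbdd y hy.1⟩ hset).trans (hmin i hf)

theorem ord_eq_of_forall_mem_filtR_iff {J : Ideal (MvPolynomial (Fin n) K)}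
    {f : MvPolynomial (Fin n) K ⧸ J} {d : ℤ} (h : ∀ i, f ∈ filtR J i ↔ d ≤ i) :
    ord J f = d := by
  have : {i : ℤ | f ∈ filtR J i ∧ f ∉ filtR J (i - 1)} = {d} := by
    ext i
    simp only [Set.mem_ofPred_eq, h, Set.mem_singleton_iff]
    omega
  rw [ord, this, csInf_singleton]

namespace IsDegreeCompatible

variable {I : Ideal (MvPolynomial (Fin n) K)} {t : Fin μ → Fin n →₀ ℕ}

theorem linearIndependent (h : IsDegreeCompatible I t) : LinearIndependent K (residues I t) :=
  linearIndependent_residues_iff.2 h.eq_zero_of_mem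

theorem filtR_eq (h : IsDegreeCompatible I t) (i : ℤ) :
    filtR I i = Submodule.span K
      (Set.range fun j : {j : Fin μ // ((t j).degree : ℤ) ≤ i} => residues I t j) := by
  rw [← map_degSpan]
  exact le_antisymm (filtR_le_map_iff.2 (h.filtP_le i)) (map_degSpan_le_filtR I t i)

theorem residues_mem_filtR_iff (h : IsDegreeCompatible I t) {j : Fin μ} {i : ℤ} :
    residues I t j ∈ filtR I i ↔ ((t j).degree : ℤ) ≤ i := by
  refine ⟨fun hj => ?_, residues_mem_filtR⟩
  by_contra hlt
  refine h.linearIndependent.notMem_span_image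
    (s := {j : Fin μ | ((t j).degree : ℤ) ≤ i}) hlt ?_
  rw [h.filtR_eq] at hj
  rwa [Set.image_eq_range]

end IsDegreeCompatible

/-! ### Degree filtered bases and the affine Hilbert function -/

theorem isDegreeCompatible_iff_isDegreeFilteredBasis {I : Ideal (MvPolynomial (Fin n) K)}
    {t : Fin μ → Fin n →₀ ℕ} (hdeg : Monotone fun i => (t i).degree) :
    IsDegreeCompatible I t ↔ IsDegreeFilteredBasis I (residues I t) ∧
      ∀ i, ord I (residues I t i) = ((t i).degree : ℤ) := by
  constructor
  · intro h
    have hord : ∀ j, ord I (residues I t j) = ((t j).degree : ℤ) := fun j =>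
      ord_eq_of_forall_mem_filtR_iff fun i => h.residues_mem_filtR_iff
    refine ⟨⟨fun i => ⟨?_, ?_⟩, fun j j' hj => ?_⟩, hord⟩
    · exact h.linearIndependent.comp _ Subtype.val_injective
    · refine le_antisymm ?_ ?_
      · rw [Submodule.span_le]
        rintro _ ⟨j, rfl⟩
        exact j.2
      · rw [h.filtR_eq, Submodule.span_le]
        rintro _ ⟨⟨j, hj⟩, rfl⟩
        rw [← h.filtR_eq]
        exact Submodule.subset_span ⟨⟨j, residues_mem_filtR hj⟩, rfl⟩
    · have := hdeg hj
      simp only [hord]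
      exact_mod_cast this
  · rintro ⟨⟨hbasis, -⟩, hord⟩
    -- All residues lie in `F_N R` for large `N`, so the basis of `F_N R` is the whole tuple.
    have hli : LinearIndependent K (residues I t) := by
      obtain ⟨N, hN⟩ := (Set.finite_range fun j => ((t j).degree : ℤ)).bddAbove
      have hmem : ∀ j, residues I t j ∈ filtR I N := fun j => residues_mem_filtR (hN ⟨j, rfl⟩)
      exact (hbasis N).1.comp (fun j => ⟨j, hmem j⟩) fun j j' hj => congrArg Subtype.val hj
    refine ⟨linearIndependent_residues_iff.1 hli, fun i => filtR_le_map_iff.1 ?_⟩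
    rw [← (hbasis i).2, Submodule.span_le]
    rintro _ ⟨⟨j, hj⟩, rfl⟩
    refine ⟨term K (t j), term_mem_degSpan ?_, rfl⟩
    rw [← hord j]
    exact ord_le_of_mem_filtR (hli.ne_zero j) hj

theorem finrank_map_degSpan {I : Ideal (MvPolynomial (Fin n) K)} {t : Fin μ → Fin n →₀ ℕ}
    (hli : LinearIndependent K (residues I t)) (i : ℕ) :
    Module.finrank K ((degSpan K t i).map (Ideal.Quotient.mkₐ K I).toLinearMap) =
      Nat.card {j : Fin μ // (t j).degree ≤ i} := by
  rw [map_degSpan]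
  refine (finrank_span_eq_card (hli.comp _ Subtype.val_injective)).trans ?_
  rw [← Nat.card_eq_fintype_card]
  simp only [Nat.cast_le]

theorem isDegreeCompatible_iff_affineHilbert {I : Ideal (MvPolynomial (Fin n) K)}
    [Module.Finite K (MvPolynomial (Fin n) K ⧸ I)] {t : Fin μ → Fin n →₀ ℕ}
    (ht : Function.Injective t) :
    IsDegreeCompatible I t ↔ IsBasisOf (residues I t) (⊤ : Submodule K _) ∧
      ∀ i : ℕ, affineHilbert I (i : ℤ) = Nat.card {j : Fin μ // (t j).degree ≤ i} := by
  constructor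
  · refine fun h => ⟨h.isBasisOf ht, fun i => ?_⟩
    rw [← finrank_map_degSpan h.linearIndependent, affineHilbert, h.filtR_eq, map_degSpan]
  · rintro ⟨⟨hli, -⟩, hHF⟩
    refine ⟨linearIndependent_residues_iff.1 hli, fun i => ?_⟩
    rcases lt_or_ge i 0 with hi | hi
    · rw [filtP_eq_bot hi]
      exact bot_le
    · lift i to ℕ using hi
      rw [← filtR_le_map_iff]
      exact (Submodule.eq_of_le_of_finrank_eq (map_degSpan_le_filtR I t i)
        ((finrank_map_degSpan hli i).trans (hHF i).symm)).ge

/-! ### Border prebases and reduction -/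

section

variable {t : Fin μ → Fin n →₀ ℕ} {b : Fin ν → Fin n →₀ ℕ} {g : Fin ν → MvPolynomial (Fin n) K}

theorem isBorderPrebasis_iff :
    IsBorderPrebasis t b g ↔
      ∃ γ : Fin ν → Fin μ → K, ∀ j, g j = term K (b j) - termSum t (γ j) :=
  ⟨fun ⟨γ, h⟩ => ⟨fun j i => γ i j, h⟩, fun ⟨γ, h⟩ => ⟨fun i j => γ j i, h⟩⟩

theorem border_notMem_range (hborder : Set.range b = border (Set.range t)) (j : Fin ν) :
    b j ∉ Set.range t := by
  have h : b j ∈ border (Set.range t) := hborder ▸ ⟨j, rfl⟩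
  exact h.2

theorem mem_support_degreeForm_iff {f : MvPolynomial (Fin n) K} {m : Fin n →₀ ℕ} :
    m ∈ (degreeForm f).support ↔ m ∈ f.support ∧ m.degree = f.totalDegree := by
  rw [degreeForm, support_homogeneousComponent, Finset.mem_filter]

theorem coeff_border {j : Fin ν} (hj : b j ∉ Set.range t) (c : Fin μ → K) :
    coeff (b j) (term K (b j) - termSum t c) = 1 := by
  rw [coeff_sub, coeff_term, if_pos rfl, coeff_termSum_of_notMem c hj, sub_zero]

theorem degree_le_of_mem_support_degreeForm (ht : Function.Injective t) {j : Fin ν}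
    (hj : b j ∉ Set.range t) {c : Fin μ → K}
    (h : b j ∈ (degreeForm (term K (b j) - termSum t c)).support) {i : Fin μ} (hi : c i ≠ 0) :
    (t i).degree ≤ (b j).degree := by
  have hne : b j ≠ t i := fun h => hj ⟨i, h.symm⟩
  have h1 := mem_filtP_iff.1 (mem_filtP_totalDegree (term K (b j) - termSum t c)) (t i) (by
    rw [coeff_sub, coeff_term, if_neg hne, coeff_termSum ht, zero_sub]
    exact neg_ne_zero.2 hi)
  rw [(mem_support_degreeForm_iff.1 h).2]
  exact_mod_cast h1

theorem totalDegree_eq_degree_border {j : Fin ν} (hj : b j ∉ Set.range t) {c : Fin μ → K}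
    (hc : ∀ i, c i ≠ 0 → (t i).degree ≤ (b j).degree) :
    (term K (b j) - termSum t c).totalDegree = (b j).degree := by
  refine le_antisymm ?_ ?_
  · have h : term K (b j) - termSum t c ∈ filtP K n (b j).degree :=
      sub_mem (term_mem_filtP le_rfl) (degSpan_le_filtP t _ (termSum_mem_degSpan fun i hi => by
        exact_mod_cast hc i hi))
    rcases h with h | h
    · rw [h, totalDegree_zero]
      exact Nat.zero_le _
    · exact_mod_cast h
  · exact le_totalDegree (mem_support_iff.2 (by
      rw [coeff_border hj]
      exact one_ne_zero))

/-- Border reduction: if each `g j` rewrites its border term into terms of `O` of no larger degree,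
then every polynomial reduces modulo `J` to a combination of terms of `O` without raising the
degree. The term `x_k s` is reduced by reducing `s` first, since `x_k O` lies in `O` or in its
border. -/
theorem filtP_le_degSpan_sup {J : Ideal (MvPolynomial (Fin n) K)}
    (h0 : 0 ∈ Set.range t) (hborder : Set.range b = border (Set.range t))
    {γ : Fin ν → Fin μ → K} (hgJ : ∀ j, term K (b j) - termSum t (γ j) ∈ J)
    (hγ : ∀ j i, γ j i ≠ 0 → (t i).degree ≤ (b j).degree) (i : ℤ) :
    filtP K n i ≤ degSpan K t i ⊔ J.restrictScalars K := by
  have key : ∀ d : ℕ, ∀ a : Fin n →₀ ℕ, a.degree = d →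
      term K a ∈ degSpan K t d ⊔ J.restrictScalars K := by
    intro d
    induction d with
    | zero =>
      intro a ha
      obtain ⟨j, hj⟩ := h0
      rw [(Finsupp.degree_eq_zero_iff a).1 ha, ← hj]
      exact Submodule.mem_sup_left (term_mem_degSpan (by simp [hj]))
    | succ d ih =>
      intro a ha
      obtain ⟨k, hk⟩ : ∃ k, a k ≠ 0 := by
        by_contra! hall
        have : a = 0 := Finsupp.ext hall
        simp [this] at ha
      obtain ⟨a', rfl⟩ : ∃ a', a = a' + Finsupp.single k 1 :=
        ⟨a - Finsupp.single k 1, (tsub_add_cancel_of_le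
          (Finsupp.single_le_iff.2 (Nat.one_le_iff_ne_zero.2 hk))).symm⟩
      have ha' : a'.degree = d := by
        rw [map_add, Finsupp.degree_single] at ha
        omega
      have hX : ∀ c : Fin n →₀ ℕ, X k * term K c = term K (c + Finsupp.single k 1) := by
        intro c
        rw [term, term, X, monomial_mul, one_mul, add_comm]
      have hle : degSpan K t d ⊔ J.restrictScalars K ≤
          (degSpan K t (d + 1 : ℕ) ⊔ J.restrictScalars K).comap (LinearMap.mulLeft K (X k)) := by
        refine sup_le (degSpan_le_iff.2 fun l hl => ?_) fun f hf => ?_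
        · rw [Submodule.mem_comap, LinearMap.mulLeft_apply, hX]
          have hdeg : (t l + Finsupp.single k 1).degree = (t l).degree + 1 := by
            rw [map_add, Finsupp.degree_single]
          by_cases hmem : t l + Finsupp.single k 1 ∈ Set.range t
          · obtain ⟨l', hl'⟩ := hmem
            rw [← hl'] at hdeg ⊢
            exact Submodule.mem_sup_left (term_mem_degSpan (by omega))
          · have hb : t l + Finsupp.single k 1 ∈ Set.range b := by
              rw [hborder]
              exact ⟨⟨t l, ⟨l, rfl⟩, k, rfl⟩, hmem⟩
            obtain ⟨j, hj⟩ := hb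
            rw [← hj] at hdeg ⊢
            rw [← add_sub_cancel (termSum t (γ j)) (term K (b j))]
            refine Submodule.add_mem_sup (termSum_mem_degSpan fun i hi => ?_) (hgJ j)
            have := hγ j i hi
            omega
        · exact Submodule.mem_sup_right (J.mul_mem_left _ hf)
      have := hle (ih a' ha')
      rwa [Submodule.mem_comap, LinearMap.mulLeft_apply, hX] at this
  exact filtP_le_of_term_mem fun a ha =>
    (sup_le_sup_right (degSpan_mono (K := K) (t := t) ha) (J.restrictScalars K) :) (key _ a rfl)

/-! ### Degree forms of a border prebasis -/

/-- In the degree compatible case the coefficients of a border prebasis contained in `I` are those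
given by reducing the border terms, so that they only involve terms of admissible degree. -/
theorem IsDegreeCompatible.degree_le_border {I : Ideal (MvPolynomial (Fin n) K)}
    (h : IsDegreeCompatible I t) (ht : Function.Injective t) {a : Fin n →₀ ℕ} {c : Fin μ → K}
    (hc : term K a - termSum t c ∈ I) {i : Fin μ} (hi : c i ≠ 0) :
    (t i).degree ≤ a.degree := by
  obtain ⟨e, he, heI⟩ := exists_sub_termSum_mem ht
    (h.filtP_le _ (term_mem_filtP (K := K) (le_refl (a.degree : ℤ))))
  have : e - c = 0 := by
    refine h.eq_zero_of_mem _ ?_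
    rw [termSum_sub]
    convert sub_mem hc heI using 1
    ring
  rw [← sub_eq_zero.1 this] at hi
  exact_mod_cast he i hi

theorem IsDegreeCompatible.degreeForm_eq {I : Ideal (MvPolynomial (Fin n) K)}
    (h : IsDegreeCompatible I t) (ht : Function.Injective t) {j : Fin ν} (hj : b j ∉ Set.range t)
    {c : Fin μ → K} (hc : term K (b j) - termSum t c ∈ I) :
    degreeForm (term K (b j) - termSum t c) =
      term K (b j) - termSum t (degPart t (b j).degree c) := by
  rw [degreeForm, totalDegree_eq_degree_border hj fun i hi => h.degree_le_border ht hc hi,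
    map_sub, homogeneousComponent_term, if_pos rfl, termSum_degPart]

theorem isDegreeCompatible_iff_mem_support {I : Ideal (MvPolynomial (Fin n) K)} (hI : I ≠ ⊤)
    (ht : Function.Injective t) (hO : IsOrderIdeal (Set.range t))
    (hborder : Set.range b = border (Set.range t))
    (hg : IsBorderPrebasis t b g) (hgI : ∀ j, g j ∈ I) :
    IsDegreeCompatible I t ↔ IsBasisOf (residues I t) (⊤ : Submodule K _) ∧
      ∀ j, b j ∈ (degreeForm (g j)).support := by
  obtain ⟨γ, hγ⟩ := isBorderPrebasis_iff.1 hg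
  obtain rfl : g = fun j => term K (b j) - termSum t (γ j) := funext hγ
  have hb := border_notMem_range hborder
  constructor
  · refine fun h => ⟨h.isBasisOf ht, fun j => mem_support_degreeForm_iff.2 ⟨?_, ?_⟩⟩
    · rw [mem_support_iff, coeff_border (hb j)]
      exact one_ne_zero
    · exact (totalDegree_eq_degree_border (hb j)
        fun i hi => h.degree_le_border ht (hgI j) hi).symm
  · rintro ⟨hbasis, hsupp⟩
    exact ⟨(isBasisOf_residues_iff.1 hbasis).1,
      filtP_le_degSpan_sup (zero_mem_range hI hO hbasis) hborder hgI fun j i hi =>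
        degree_le_of_mem_support_degreeForm ht (hb j) (hsupp j) hi⟩

theorem isDegreeCompatible_iff_isBorderBasis_degreeForm {I : Ideal (MvPolynomial (Fin n) K)}
    (ht : Function.Injective t) (hborder : Set.range b = border (Set.range t))
    (hg : IsBorderPrebasis t b g) (hgI : ∀ j, g j ∈ I) :
    IsDegreeCompatible I t ↔
      IsBorderBasis (degreeFormIdeal I) t b fun j => degreeForm (g j) := by
  refine ⟨fun h => ⟨?_, fun j => degreeForm_mem_degreeFormIdeal (hgI j),
    (isDegreeCompatible_iff_degreeFormIdeal ht).1 h⟩,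
    fun h => (isDegreeCompatible_iff_degreeFormIdeal ht).2 h.2.2⟩
  obtain ⟨γ, hγ⟩ := isBorderPrebasis_iff.1 hg
  refine isBorderPrebasis_iff.2 ⟨fun j => degPart t (b j).degree (γ j), fun j => ?_⟩
  have hj := hgI j
  rw [hγ j] at hj ⊢
  exact h.degreeForm_eq ht (border_notMem_range hborder j) hj

/-- If the degree forms of `g` are a border basis of `DF(I)`, then they generate `DF(I)`: modulo the
ideal they generate, each element of `DF(I)` reduces to a combination of terms of `O`, which
vanishes by linear independence modulo `DF(I)`. -/
theorem span_degreeForm_eq {I : Ideal (MvPolynomial (Fin n) K)} (hI : I ≠ ⊤)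
    (ht : Function.Injective t) (hO : IsOrderIdeal (Set.range t))
    (hborder : Set.range b = border (Set.range t))
    (hg : IsBorderPrebasis t b g) (hgI : ∀ j, g j ∈ I)
    (h : IsBorderBasis (degreeFormIdeal I) t b fun j => degreeForm (g j)) :
    Ideal.span (Set.range fun j => degreeForm (g j)) = degreeFormIdeal I := by
  have hcomp := (isDegreeCompatible_iff_isBorderBasis_degreeForm ht hborder hg hgI).2 h
  obtain ⟨γ, hγ⟩ := isBorderPrebasis_iff.1 hg
  have hle : Ideal.span (Set.range fun j => degreeForm (g j)) ≤ degreeFormIdeal I := by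
    rw [Ideal.span_le]
    rintro _ ⟨j, rfl⟩
    exact h.2.1 j
  have hmem : ∀ j, term K (b j) - termSum t (degPart t (b j).degree (γ j)) ∈
      Ideal.span (Set.range fun j => degreeForm (g j)) := by
    intro j
    have hj := hgI j
    rw [hγ j] at hj
    rw [← hcomp.degreeForm_eq ht (border_notMem_range hborder j) hj, ← hγ j]
    exact Ideal.subset_span ⟨j, rfl⟩
  refine le_antisymm hle fun f hf => ?_
  obtain ⟨c, -, hc⟩ := exists_sub_termSum_mem ht
    (filtP_le_degSpan_sup (zero_mem_range hI hO (hcomp.isBasisOf ht)) hborder hmem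
      (fun j i hi => (degree_eq_of_degPart_ne_zero hi).le) _ (mem_filtP_totalDegree f))
  have hc0 : c = 0 := by
    refine (isBasisOf_residues_iff.1 h.2.2).1 c ?_
    rw [← sub_sub_cancel f (termSum t c)]
    exact sub_mem hf (hle hc)
  simpa [hc0, termSum] using hc

theorem exists_isBorderBasis_iff {I : Ideal (MvPolynomial (Fin n) K)}
    (hg : IsBorderPrebasis t b g) (hgI : ∀ j, g j ∈ I) :
    (∃ g', IsBorderBasis I t b g') ↔ IsBasisOf (residues I t) (⊤ : Submodule K _) :=
  ⟨fun ⟨_, h⟩ => h.2.2, fun h => ⟨g, hg, hgI, h⟩⟩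

end

end BorderBasis

theorem proposition5p3 {K : Type*} [Field K] {n : ℕ}
    (I : Ideal (MvPolynomial (Fin n) K)) (hI : I ≠ ⊤)
    (hfin : Module.Finite K (MvPolynomial (Fin n) K ⧸ I))
    {μ ν : ℕ} (t : Fin μ → Fin n →₀ ℕ) (ht : Function.Injective t)
    (hO : BorderBasis.IsOrderIdeal (Set.range t))
    (hdeg : Monotone fun i => (t i).degree)
    (b : Fin ν → Fin n →₀ ℕ) (hb : Function.Injective b)
    (hborder : Set.range b = BorderBasis.border (Set.range t))
    (g : Fin ν → MvPolynomial (Fin n) K)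
    (hg : BorderBasis.IsBorderPrebasis t b g) (hgI : ∀ j, g j ∈ I) :
    List.TFAE [
      -- (a)
      BorderBasis.IsDegreeFilteredBasis I (BorderBasis.residues I t) ∧
        ∀ i, BorderBasis.ord I (BorderBasis.residues I t i) = ((t i).degree : ℤ),
      -- (b)
      BorderBasis.IsBasisOf (BorderBasis.residues (BorderBasis.degreeFormIdeal I) t)
        (⊤ : Submodule K _),
      -- (c)
      (∃ g' : Fin ν → MvPolynomial (Fin n) K, BorderBasis.IsBorderBasis I t b g') ∧
        ∀ i : ℕ, BorderBasis.affineHilbert I (i : ℤ) = Nat.card {j : Fin μ // (t j).degree ≤ i},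
      -- (d)
      (∃ g' : Fin ν → MvPolynomial (Fin n) K, BorderBasis.IsBorderBasis I t b g') ∧
        ∀ j, b j ∈ (BorderBasis.degreeForm (g j)).support,
      -- (e)
      BorderBasis.IsBorderBasis (BorderBasis.degreeFormIdeal I) t b
        (fun j => BorderBasis.degreeForm (g j))] ∧
    (BorderBasis.IsBorderBasis (BorderBasis.degreeFormIdeal I) t b
        (fun j => BorderBasis.degreeForm (g j)) →
      Ideal.span (Set.range fun j => BorderBasis.degreeForm (g j)) =
        BorderBasis.degreeFormIdeal I) := by
  have hA := BorderBasis.isDegreeCompatible_iff_isDegreeFilteredBasis (I := I) hdeg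
  have hB := BorderBasis.isDegreeCompatible_iff_degreeFormIdeal (I := I) ht
  have hC := BorderBasis.isDegreeCompatible_iff_affineHilbert (I := I) ht
  have hD := BorderBasis.isDegreeCompatible_iff_mem_support hI ht hO hborder hg hgI
  have hE := BorderBasis.isDegreeCompatible_iff_isBorderBasis_degreeForm ht hborder hg hgI
  rw [BorderBasis.exists_isBorderBasis_iff hg hgI]
  refine ⟨?_, BorderBasis.span_degreeForm_eq hI ht hO hborder hg hgI⟩
  tfae_have 1 ↔ 2 := hA.symm.trans hB
  tfae_have 1 ↔ 3 := hA.symm.trans hC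
  tfae_have 1 ↔ 4 := hA.symm.trans hD
  tfae_have 1 ↔ 5 := hA.symm.trans hE
  tfae_finish
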